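/- Let $(\mathscr{A},\tau)$ be a $W^\star$-non commutative probability space, i.e. a von Neumann algebra $\mathscr{A}$ with unit ${\bf 1}$ endowed with a faithful tracial state $\tau$. Let $P\in\mathscr{A}$ be an orthogonal projection and let $U\in\mathscr{A}$ be a Haar unitary (a unitary with $\tau(U^k)=0$ for every $k\in\mathbb{Z}\setminus\{0\}$) such that $P$ and $U$ are $\star$-free in Voiculescu's sense. Put $S=2P-{\bf 1}$ and $\kappa=\tau(S)=2\tau(P)-1$, and suppose that $\kappa\in(-1,1]$. Let $\mu_\infty$ be the spectral distribution of the unitary operator $SUSU^\star$, i.e. the measure on the unit circle $\mathbb{T}$ such that $\int_{\mathbb{T}} f\,d\mu_\infty=\tau(f(SUSU^\star))$ for every continuous $f$ on $\mathbb{T}$. Then for every integer $n\ge 1$ the moment $$r_n:=\int_{\mathbb{T}} z^n\,\mu_\infty(dz)=\tau\big((SUSU^\star)^n\big)$$ is given by $$r_n=\kappa\int_0^{\kappa}P^{(1,0)}_{n-1}(1-2s^2)\,ds,$$ where $P^{(\alpha,\beta)}_m(x)=\frac{(\alpha+1)_m}{m!}\,{}_2F_1\!\left(-m,\,m+\alpha+\beta+1;\,\alpha+1;\,\tfrac{1-x}{2}\right)$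 is the $m$-th Jacobi polynomial with parameters $(\alpha,\beta)$, $(x)_k=x(x+1)\cdots(x+k-1)$, and the integral is oriented if $\kappa<0$. -/

import Mathlib

open MeasureTheory Polynomial
open scoped ComplexOrder

noncomputable section

/-- A faithful tracial state on a unital C⋆-algebra. -/
structure FaithfulTracialState (A : Type*) [CStarAlgebra A] where
  toLinearMap : A →ₗ[ℂ] ℂ
  map_one' : toLinearMap 1 = 1
  nonneg' : ∀ a : A, 0 ≤ toLinearMap (star a * a)
  faithful' : ∀ a : A, toLinearMap (star a * a) = 0 → a = 0
  tracial' : ∀ a b : A, toLinearMap (a * b) = toLinearMap (b * a)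

instance FaithfulTracialState.instCoeFun (A : Type*) [CStarAlgebra A] :
    CoeFun (FaithfulTracialState A) (fun _ => A → ℂ) where
  coe τ := τ.toLinearMap

/-- A family of sets of elements is ⋆-free (in Voiculescu's sense) with respect to `τ`: if
`a₀, …, aₙ` are `τ`-centred elements of the unital ⋆-algebras generated by the members of the
family, and consecutive elements come from different algebras, then `τ (a₀ ⋯ aₙ) = 0`. -/
def IsStarFree {A : Type*} [CStarAlgebra A] (τ : FaithfulTracialState A) {ι : Type*}
    (X : ι → Set A) : Prop :=
  ∀ (n : ℕ) (i : Fin (n + 1) → ι) (a : Fin (n + 1) → A),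
    (∀ k : Fin n, i k.castSucc ≠ i k.succ) →
    (∀ k, a k ∈ StarAlgebra.adjoin ℂ (X (i k))) →
    (∀ k, τ (a k) = 0) →
    τ (List.ofFn a).prod = 0

/-- A unitary is Haar distributed if all its nonzero (positive and negative) moments vanish. -/
def IsHaarUnitary {A : Type*} [CStarAlgebra A] (τ : FaithfulTracialState A)
    (u : unitary A) : Prop :=
  ∀ k : ℤ, k ≠ 0 → τ ((u ^ k : unitary A) : A) = 0

/-- The continuous functional calculus `f ↦ f(w)` of a unitary `w`, for continuous functions on the
unit circle. -/
def circleCalculus {A : Type*} [CStarAlgebra A] (w : unitary A) : C(Metric.sphere (0 : ℂ) 1, ℂ) →⋆ₐ[ℂ] A :=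
  (cfcHom (R := ℂ) (a := (w : A)) (p := IsStarNormal) inferInstance).comp
    (ContinuousMap.compStarAlgHom' ℂ ℂ
      ⟨fun z : spectrum ℂ (w : A) =>
          (⟨z.1, Unitary.spectrum_subset_circle (𝕜 := ℂ) w z.2⟩ : Metric.sphere (0 : ℂ) 1),
        Continuous.subtype_mk continuous_subtype_val _⟩)

theorem circleCalculus_nonneg {A : Type*} [CStarAlgebra A] (τ : FaithfulTracialState A)
    (w : unitary A) (f : C(Metric.sphere (0 : ℂ) 1, ℝ)) (hf : ∀ z, 0 ≤ f z) :
    0 ≤ (τ (circleCalculus w ⟨fun z => (f z : ℂ), by fun_prop⟩)).re := by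
  set g : C(Metric.sphere (0 : ℂ) 1, ℂ) := ⟨fun z => (Real.sqrt (f z) : ℂ), by fun_prop⟩ with hg
  have h : (⟨fun z => (f z : ℂ), by fun_prop⟩ : C(Metric.sphere (0 : ℂ) 1, ℂ)) = star g * g := by
    ext z
    simp only [hg, ContinuousMap.coe_mk, ContinuousMap.mul_apply, ContinuousMap.star_apply,
      RCLike.star_def, Complex.conj_ofReal]
    rw [← Complex.ofReal_mul, Real.mul_self_sqrt (hf z)]
  rw [h, map_mul, map_star]
  exact (Complex.nonneg_iff.mp (τ.nonneg' (circleCalculus w g))).1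

/-- The positive functional `f ↦ τ (f(w))` on real continuous functions on the unit circle. -/
def spectralFunctional {A : Type*} [CStarAlgebra A] (τ : FaithfulTracialState A)
    (w : unitary A) : CompactlySupportedContinuousMap (Metric.sphere (0 : ℂ) 1) ℝ →ₚ[ℝ] ℝ :=
  PositiveLinearMap.mk₀
    { toFun := fun f => (τ (circleCalculus w ⟨fun z => (f z : ℂ), by fun_prop⟩)).re
      map_add' := fun f g => by
        rw [← Complex.add_re, ← map_add, ← map_add]
        congr 3
        ext z
        simp
      map_smul' := fun c f => by
        have h : (⟨fun z => ((c • f) z : ℂ), by fun_prop⟩ : C(Metric.sphere (0 : ℂ) 1, ℂ))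
            = (c : ℂ) • ⟨fun z => (f z : ℂ), by fun_prop⟩ := by
          ext z
          simp
        rw [h, map_smul, map_smul]
        simp }
    (fun f hf => circleCalculus_nonneg τ w f.toContinuousMap hf)

/-- The spectral distribution of a unitary `w`: the measure `μ` on the unit circle representing
`f ↦ τ (f(w))`, i.e. `∫ f dμ = τ (f(w))` for every continuous `f`. -/
def spectralDistribution {A : Type*} [CStarAlgebra A] (τ : FaithfulTracialState A)
    (w : unitary A) : Measure (Metric.sphere (0 : ℂ) 1) :=
  RealRMK.rieszMeasure (spectralFunctional τ w)

/-- The Jacobi polynomial `P_n^{(α,β)}`, i.e. `(α+1)_n / n! · ₂F₁(-n, n+α+β+1; α+1; (1-X)/2)`, with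
the quotient `(α+1)_n / (α+1)_k` written as `(α+k+1)_{n-k}`. -/
def jacobiPoly (α β : ℝ) (n : ℕ) : ℝ[X] :=
  ∑ k ∈ Finset.range (n + 1),
    C ((ascPochhammer ℝ (n - k)).eval (α + k + 1) * (ascPochhammer ℝ k).eval (n + α + β + 1)
      / ((k.factorial : ℝ) * ((n - k).factorial : ℝ))) * (C (1 / 2) * (X - 1)) ^ k

end

/-! Write `T = U S U⋆`. Then `S` and `T` are free involutions of trace `κ`. Let `∂` be the
derivation into `A ⊗ A` with `∂ S = 0` and `∂ T = 1 ⊗ T - T ⊗ 1`. Freeness forces `τ ⊗ τ` to vanish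
on the values of `∂` (`tensorSquare_snd_of_mem`). For `(S T) ^ n`, where odd alternating words have
trace `κ`, this gives `∑ r_{j+1} r_{n-1-j} = n κ²` (`sum_moments_mul_moments`).

So `F = ∑_{n ≥ 1} r_n X^n` satisfies `F + F² = κ² X / (1 - X)²`. The root with zero constant term is
a signed Catalan series composed with `X / (1 - X)²` (`eq_of_sum_mul_eq`), and its coefficients are
those of the integrated Jacobi polynomial (`mul_integral_jacobiPoly`).

Pairs `(w, ∂ w)` are carried along, so `∂` never has to be shown well defined on `A`. -/

noncomputable section

/-! ### The liberation derivation and the quadratic recursion for the moments. -/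

section Liberation

open TensorProduct

variable {R A : Type*} [CommRing R] [Ring A] [Algebra R A]

/-- The alternating product of length `n` of the centred letters `e b - κ`, starting with the
letter `b`. -/
def centredWord (e : Bool → A) (κ : R) : Bool → ℕ → A
  | _, 0 => 1
  | b, n + 1 => (e b - algebraMap R A κ) * centredWord e κ (!b) n

/-- Left multiplication by the letter `e b` on pairs `(w, ∂ w)`, where `∂` is the derivation with
`∂ (e false) = 0` and `∂ (e true) = 1 ⊗ e true - e true ⊗ 1`. -/
def liberationMul (e : Bool → A) (b : Bool) : A × (A ⊗[R] A) →ₗ[R] A × (A ⊗[R] A) :=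
  LinearMap.prod (LinearMap.mulLeft R (e b) ∘ₗ LinearMap.fst R _ _)
    (LinearMap.mulLeft R (e b ⊗ₜ[R] (1 : A)) ∘ₗ LinearMap.snd R _ _ +
      (if b then (1 : R) else 0) • (TensorProduct.mk R A A 1 ∘ₗ LinearMap.mulLeft R (e b)
        - TensorProduct.mk R A A (e b)) ∘ₗ LinearMap.fst R _ _)

theorem liberationMul_apply (e : Bool → A) (b : Bool) (x : A × (A ⊗[R] A)) :
    liberationMul e b x = (e b * x.1, (e b ⊗ₜ[R] (1 : A)) * x.2 +
      (if b then (1 : R) else 0) • ((1 : A) ⊗ₜ[R] (e b * x.1) - e b ⊗ₜ[R] x.1)) := rfl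

/-- The derivation respects the relation `e b ^ 2 = 1`: the two Leibniz terms of `∂ (e b * e b)`
cancel. -/
theorem liberationMul_liberationMul (e : Bool → A) (he : ∀ b, e b * e b = 1) (b : Bool)
    (x : A × (A ⊗[R] A)) : liberationMul e b (liberationMul e b x) = x := by
  have h : (e b ⊗ₜ[R] (1 : A)) * (e b ⊗ₜ[R] (1 : A)) = 1 := by
    rw [Algebra.TensorProduct.tmul_mul_tmul, he, one_mul, Algebra.TensorProduct.one_def]
  rw [liberationMul_apply, liberationMul_apply]
  refine Prod.ext ?_ ?_
  · simp [← mul_assoc, he]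
  · cases b
    · simp [← mul_assoc, h]
    · simp only [↓reduceIte, one_smul, mul_add, mul_sub, ← mul_assoc, h, he,
        Algebra.TensorProduct.tmul_mul_tmul, one_mul, mul_one]
      abel

/-- The pair `(w, ∂ w)` for the alternating centred word `w` of length `n` starting with `b`. -/
def liberationWord (e : Bool → A) (κ : R) : Bool → ℕ → A × (A ⊗[R] A)
  | _, 0 => (1, 0)
  | b, n + 1 => liberationMul e b (liberationWord e κ (!b) n) - κ • liberationWord e κ (!b) n

theorem liberationWord_fst (e : Bool → A) (κ : R) (b : Bool) (n : ℕ) :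
    (liberationWord e κ b n).1 = centredWord e κ b n := by
  induction n generalizing b with
  | zero => rfl
  | succ n ih =>
    simp [liberationWord, centredWord, liberationMul_apply, ih, sub_mul, Algebra.smul_def]

/-- Scalars are killed by `∂`, so the Leibniz rule may be written with centred letters throughout.
-/
theorem liberationWord_snd_succ (e : Bool → A) (κ : R) (b : Bool) (n : ℕ) :
    (liberationWord e κ b (n + 1)).2 =
      ((e b - algebraMap R A κ) ⊗ₜ[R] (1 : A)) * (liberationWord e κ (!b) n).2 +
      (if b then (1 : R) else 0) • ((1 : A) ⊗ₜ[R] centredWord e κ b (n + 1)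
        - (e b - algebraMap R A κ) ⊗ₜ[R] centredWord e κ (!b) n) := by
  have h : ((algebraMap R A κ) ⊗ₜ[R] (1 : A)) * (liberationWord e κ (!b) n).2
      = κ • (liberationWord e κ (!b) n).2 := by
    rw [Algebra.algebraMap_eq_smul_one, ← TensorProduct.smul_tmul',
      ← Algebra.TensorProduct.one_def, smul_mul_assoc, one_mul]
  have h' : (1 : A) ⊗ₜ[R] (algebraMap R A κ * centredWord e κ (!b) n)
      = algebraMap R A κ ⊗ₜ[R] centredWord e κ (!b) n := by
    rw [Algebra.algebraMap_eq_smul_one, smul_mul_assoc, one_mul, TensorProduct.tmul_smul,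
      TensorProduct.smul_tmul']
  rw [liberationWord, Prod.snd_sub, liberationMul_apply, Prod.smul_snd, liberationWord_fst,
    centredWord, TensorProduct.sub_tmul, TensorProduct.sub_tmul, sub_mul, sub_mul,
    TensorProduct.tmul_sub, h, h']
  module

/-- The functional `τ ⊗ τ`. -/
def tensorSquare (τ : A →ₗ[R] R) : A ⊗[R] A →ₗ[R] R :=
  LinearMap.mul' R R ∘ₗ TensorProduct.map τ τ

@[simp]
theorem tensorSquare_tmul (τ : A →ₗ[R] R) (a b : A) :
    tensorSquare τ (a ⊗ₜ[R] b) = τ a * τ b := by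
  simp [tensorSquare]

/-- Each term of `∂ w` cuts `w` next to a letter `true`, and the piece keeping that letter is
traceless: a suffix by `hw`, a prefix by `hp`. The prefix `p` stands for the letters already read,
which makes the induction close. -/
theorem tensorSquare_mul_liberationWord (τ : A →ₗ[R] R) (e : Bool → A) (κ : R)
    (hw : ∀ b n, τ (centredWord e κ b (n + 1)) = 0) (n : ℕ) (b : Bool) (p : A)
    (hp : ∀ m, τ (p * centredWord e κ b (m + 1)) = 0) :
    tensorSquare τ ((p ⊗ₜ[R] (1 : A)) * (liberationWord e κ b n).2) = 0 := by
  induction n generalizing b p with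
  | zero => simp [liberationWord]
  | succ n ih =>
    have h1 : τ (p * (e b - algebraMap R A κ)) = 0 := by
      simpa [centredWord] using hp 0
    have h2 := ih (!b) (p * (e b - algebraMap R A κ)) fun m => by
      have := hp (m + 1)
      rwa [centredWord, ← mul_assoc] at this
    rw [liberationWord_snd_succ, mul_add, ← mul_assoc, Algebra.TensorProduct.tmul_mul_tmul,
      one_mul, map_add, h2, mul_smul_comm, mul_sub, Algebra.TensorProduct.tmul_mul_tmul,
      Algebra.TensorProduct.tmul_mul_tmul, map_smul, map_sub, tensorSquare_tmul,
      tensorSquare_tmul, one_mul, h1, hw]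
    simp

theorem tensorSquare_liberationWord (τ : A →ₗ[R] R) (e : Bool → A) (κ : R)
    (hw : ∀ b n, τ (centredWord e κ b (n + 1)) = 0) (n : ℕ) (b : Bool) :
    tensorSquare τ (liberationWord e κ b n).2 = 0 := by
  have := tensorSquare_mul_liberationWord τ e κ hw n b 1 (by simpa using hw b)
  rwa [← Algebra.TensorProduct.one_def, one_mul] at this

/-- The span of the pairs `(w, ∂ w)` for all alternating centred words `w`. -/
def liberationSpan (e : Bool → A) (κ : R) : Submodule R (A × (A ⊗[R] A)) :=
  Submodule.span R (Set.range fun p : Bool × ℕ => liberationWord e κ p.1 p.2)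

theorem liberationWord_mem (e : Bool → A) (κ : R) (b : Bool) (n : ℕ) :
    liberationWord e κ b n ∈ liberationSpan e κ :=
  Submodule.subset_span ⟨(b, n), rfl⟩

/-- A new letter either extends a centred word, up to a multiple of `κ`, or meets its own copy and
is absorbed by `e b ^ 2 = 1`. Hence the span contains the pair of every word in the letters. -/
theorem liberationMul_mem (e : Bool → A) (he : ∀ b, e b * e b = 1) (κ : R) (b : Bool)
    {x : A × (A ⊗[R] A)} (hx : x ∈ liberationSpan e κ) :
    liberationMul e b x ∈ liberationSpan e κ := by
  have key (n : ℕ) : liberationMul e b (liberationWord e κ (!b) n) ∈ liberationSpan e κ := by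
    have h := add_mem (liberationWord_mem e κ b (n + 1))
      (Submodule.smul_mem _ κ (liberationWord_mem e κ (!b) n))
    rwa [liberationWord, sub_add_cancel] at h
  refine Submodule.span_induction (p := fun x _ => liberationMul e b x ∈ liberationSpan e κ)
    ?_ ?_ ?_ ?_ hx
  · rintro _ ⟨⟨c, n⟩, rfl⟩
    obtain rfl | rfl : c = !b ∨ c = b := by cases b <;> cases c <;> simp
    · exact key n
    · cases n with
      | zero => exact key 0
      | succ n =>
        simp only [liberationWord, map_sub, map_smul, liberationMul_liberationMul e he]
        exact sub_mem (liberationWord_mem e κ (!c) n) (Submodule.smul_mem _ κ (key n))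
  · simp
  · intro x y _ _ hx hy
    rw [map_add]
    exact add_mem hx hy
  · intro a x _ hx
    rw [map_smul]
    exact Submodule.smul_mem _ a hx

theorem tensorSquare_snd_of_mem (τ : A →ₗ[R] R) (e : Bool → A) (κ : R)
    (hw : ∀ b n, τ (centredWord e κ b (n + 1)) = 0)
    {x : A × (A ⊗[R] A)} (hx : x ∈ liberationSpan e κ) : tensorSquare τ x.2 = 0 := by
  refine Submodule.span_induction (p := fun x _ => tensorSquare τ x.2 = 0) ?_ ?_ ?_ ?_ hx
  · rintro _ ⟨⟨c, n⟩, rfl⟩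
    exact tensorSquare_liberationWord τ e κ hw n c
  · simp
  · intro x y _ _ hx hy
    simp [hx, hy]
  · intro a x _ hx
    simp [hx]

/-- The pair `(w, ∂ w)` for the word `w = (e false * e true) ^ n`, with `∂ w` expanded by the
Leibniz rule. -/
theorem liberationMul_iterate (e : Bool → A) (n : ℕ) :
    (fun x => liberationMul (R := R) e false (liberationMul e true x))^[n] (1, 0) =
      ((e false * e true) ^ n, ∑ j ∈ Finset.range n,
        (((e false * e true) ^ j * e false) ⊗ₜ[R] (e true * (e false * e true) ^ (n - 1 - j)) -
          ((e false * e true) ^ (j + 1)) ⊗ₜ[R] ((e false * e true) ^ (n - 1 - j)))) := by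
  induction n with
  | zero => simp
  | succ n ih =>
    rw [Function.iterate_succ_apply', ih, liberationMul_apply, liberationMul_apply]
    refine Prod.ext ?_ ?_
    · simp [pow_succ', mul_assoc]
    · rw [Finset.sum_range_succ']
      simp only [↓reduceIte, one_smul, zero_smul, add_zero, mul_add, mul_sub, Finset.mul_sum,
        Algebra.TensorProduct.tmul_mul_tmul, one_mul, Bool.false_eq_true, mul_one, pow_zero,
        Nat.add_sub_cancel, Nat.sub_zero, zero_add, pow_one]
      congr 1
      refine Finset.sum_congr rfl fun j hj => ?_
      rw [show n - (j + 1) = n - 1 - j by omega]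
      simp only [pow_succ', mul_assoc]

/-- An odd alternating word begins and ends with the same involution; traciality cancels these two
letters, down to a single one. -/
theorem trace_alternating_odd (τ : A →ₗ[R] R) (hτ : ∀ a b, τ (a * b) = τ (b * a)) (e : Bool → A)
    (he : ∀ b, e b * e b = 1) (κ : R) (hκ : ∀ b, τ (e b) = κ) (j : ℕ) :
    τ ((e false * e true) ^ j * e false) = κ ∧ τ (e true * (e false * e true) ^ j) = κ := by
  induction j with
  | zero => simp [hκ]
  | succ j ih =>
    constructor
    · rw [hτ, pow_succ', ← mul_assoc, ← mul_assoc, he, one_mul, ih.2]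
    · rw [hτ, pow_succ, mul_assoc, mul_assoc, he, mul_one, ih.1]

theorem sum_moments_mul_moments (τ : A →ₗ[R] R) (hτ : ∀ a b, τ (a * b) = τ (b * a))
    (e : Bool → A) (he : ∀ b, e b * e b = 1) (κ : R) (hκ : ∀ b, τ (e b) = κ)
    (hw : ∀ b n, τ (centredWord e κ b (n + 1)) = 0) (n : ℕ) :
    ∑ j ∈ Finset.range n, τ ((e false * e true) ^ (j + 1)) * τ ((e false * e true) ^ (n - 1 - j))
      = n * κ ^ 2 := by
  have hmem : ∀ n : ℕ, (fun x => liberationMul (R := R) e false (liberationMul e true x))^[n] (1, 0)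
      ∈ liberationSpan e κ := by
    intro n
    induction n with
    | zero => exact liberationWord_mem e κ false 0
    | succ n ih =>
      rw [Function.iterate_succ_apply']
      exact liberationMul_mem e he κ _ (liberationMul_mem e he κ _ ih)
  have h := tensorSquare_snd_of_mem τ e κ hw (hmem n)
  rw [liberationMul_iterate] at h
  simp only [map_sum, map_sub, tensorSquare_tmul,
    (trace_alternating_odd τ hτ e he κ hκ _).1, (trace_alternating_odd τ hτ e he κ hκ _).2,
    Finset.sum_sub_distrib, Finset.sum_const, Finset.card_range, nsmul_eq_mul] at h
  rw [← sub_eq_zero.mp h, sq]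

end Liberation

/-! ### Alternating centred words in `S` and `U S U⋆` are traceless. -/

section Freeness

variable {A : Type*} [CStarAlgebra A]

theorem IsStarFree.apply_list_prod {τ : FaithfulTracialState A} {ι : Type*} {X : ι → Set A}
    (h : IsStarFree τ X) (l : List (ι × A)) (hl : l ≠ [])
    (hc : l.IsChain fun x y => x.1 ≠ y.1) (hX : ∀ x ∈ l, x.2 ∈ StarAlgebra.adjoin ℂ (X x.1))
    (h0 : ∀ x ∈ l, τ x.2 = 0) : τ (l.map Prod.snd).prod = 0 := by
  obtain ⟨n, hn⟩ := Nat.exists_eq_succ_of_ne_zero (List.length_pos_iff.mpr hl).ne'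
  have key := h n (fun k => (l[k.1]'(by omega)).1) (fun k => (l[k.1]'(by omega)).2)
    (fun k => List.isChain_iff_getElem.mp hc k.1 (by omega))
    (fun k => hX _ (List.getElem_mem _)) (fun k => h0 _ (List.getElem_mem _))
  convert key using 3
  refine List.ext_getElem (by rw [List.length_map, List.length_ofFn, hn]) fun i h1 h2 => ?_
  rw [List.getElem_map, List.getElem_ofFn]

/-- The letters, labelled by `0` for `S` and by `1` for `U`, of the alternating word of length `n`
in `s` and `U s U⋆` that starts with `s` (for `false`) or with `U s U⋆` (for `true`). -/
def freeLetters (s : A) (U : unitary A) : Bool → ℕ → List (Fin 2 × A)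
  | _, 0 => []
  | false, n + 1 => (0, s) :: freeLetters s U true n
  | true, n + 1 => (1, (U : A)) :: (0, s) :: (1, star (U : A)) :: freeLetters s U false n

theorem isChain_freeLetters (s : A) (U : unitary A) (b : Bool) (n : ℕ) :
    (freeLetters s U b n).IsChain (fun x y => x.1 ≠ y.1) := by
  induction n generalizing b with
  | zero => simp [freeLetters]
  | succ n ih =>
    have h0 := ih (!b)
    cases b <;> cases n <;> simp_all [freeLetters]

theorem prod_freeLetters (S : A) (U : unitary A) (κ : ℂ) (b : Bool) (n : ℕ) :
    ((freeLetters (S - algebraMap ℂ A κ) U b n).map Prod.snd).prod =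
      centredWord (fun b => bif b then (U : A) * S * star (U : A) else S) κ b n := by
  induction n generalizing b with
  | zero => simp [freeLetters, centredWord]
  | succ n ih =>
    cases b
    · simp [freeLetters, centredWord, ih]
    · have h : (U : A) * algebraMap ℂ A κ * star (U : A) = algebraMap ℂ A κ := by
        rw [← Algebra.commutes, mul_assoc, Unitary.mul_star_self_of_mem U.2, mul_one]
      simp only [freeLetters, List.map_cons, List.prod_cons, ih, centredWord, cond_true,
        Bool.not_true]
      rw [← mul_assoc, ← mul_assoc, mul_sub, sub_mul, h]

/-- Since `U S U⋆ - κ = U (S - κ) U⋆`, such a word alternates between centred elements `S - κ` and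
`U` or `U⋆`, so freeness of `P` and `U` applies directly. -/
theorem IsStarFree.centredWord_eq_zero {τ : FaithfulTracialState A} {P S : A} {U : unitary A}
    (h : IsStarFree τ ![{P}, {(U : A)}]) (hU : IsHaarUnitary τ U) (hS : S = 2 * P - 1) {κ : ℂ}
    (hκ : τ S = κ) (b : Bool) (n : ℕ) :
    τ (centredWord (fun b => bif b then (U : A) * S * star (U : A) else S) κ b (n + 1)) = 0 := by
  have hU1 : τ (U : A) = 0 := by simpa using hU 1 one_ne_zero
  have hU2 : τ (star (U : A)) = 0 := by
    have := hU (-1) (by norm_num)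
    rwa [zpow_neg_one, ← Unitary.star_eq_inv, Unitary.coe_star] at this
  have hs : S - algebraMap ℂ A κ ∈ StarAlgebra.adjoin ℂ ({P} : Set A) := by
    have hP : P ∈ StarAlgebra.adjoin ℂ ({P} : Set A) :=
      StarAlgebra.self_mem_adjoin_singleton ℂ P
    rw [hS, two_mul]
    exact sub_mem (sub_mem (add_mem hP hP) (one_mem _)) (algebraMap_mem _ _)
  have hs0 : τ (S - algebraMap ℂ A κ) = 0 := by
    rw [map_sub, Algebra.algebraMap_eq_smul_one, map_smul, τ.map_one', hκ]
    simp
  have hUm : (U : A) ∈ StarAlgebra.adjoin ℂ ({(U : A)} : Set A) :=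
    StarAlgebra.self_mem_adjoin_singleton ℂ _
  have key : ∀ b n, ∀ x ∈ freeLetters (S - algebraMap ℂ A κ) U b n,
      x.2 ∈ StarAlgebra.adjoin ℂ ((![{P}, {(U : A)}] : Fin 2 → Set A) x.1) ∧ τ x.2 = 0 := by
    intro b n
    induction n generalizing b with
    | zero => simp [freeLetters]
    | succ n ih =>
      intro x hx
      cases b
      · simp only [freeLetters, List.mem_cons] at hx
        rcases hx with rfl | hx
        · exact ⟨hs, hs0⟩
        · exact ih _ _ hx
      · simp only [freeLetters, List.mem_cons] at hx
        rcases hx with rfl | rfl | rfl | hx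
        · exact ⟨hUm, hU1⟩
        · exact ⟨hs, hs0⟩
        · exact ⟨star_mem hUm, hU2⟩
        · exact ih _ _ hx
  rw [← prod_freeLetters]
  exact h.apply_list_prod _ (by cases b <;> simp [freeLetters]) (isChain_freeLetters _ _ _ _)
    (fun x hx => (key _ _ x hx).1) (fun x hx => (key _ _ x hx).2)

theorem sum_moments_of_isStarFree {τ : FaithfulTracialState A} {P : A}
    (hP : IsStarProjection P) {U : unitary A} (hU : IsHaarUnitary τ U)
    (h : IsStarFree τ ![{P}, {(U : A)}]) {S : A} (hS : S = 2 * P - 1) {κ : ℂ} (hκ : τ S = κ)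
    (n : ℕ) :
    ∑ j ∈ Finset.range n, τ ((S * U * S * star (U : A)) ^ (j + 1)) *
      τ ((S * U * S * star (U : A)) ^ (n - 1 - j)) = n * κ ^ 2 := by
  have hSS : S * S = 1 := by
    have hPP : P * P = P := hP.isIdempotentElem
    rw [hS, two_mul, sub_mul, mul_sub, add_mul, mul_add, hPP]
    simp
  have hT : (U : A) * S * star (U : A) * ((U : A) * S * star (U : A)) = 1 := by
    rw [show (U : A) * S * star (U : A) * ((U : A) * S * star (U : A))
      = (U : A) * S * (star (U : A) * U) * S * star (U : A) by simp only [mul_assoc],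
      Unitary.star_mul_self_of_mem U.2, mul_one, mul_assoc (U : A), hSS, mul_one,
      Unitary.mul_star_self_of_mem U.2]
  have hTκ : τ ((U : A) * S * star (U : A)) = κ := by
    rw [τ.tracial', ← mul_assoc, Unitary.star_mul_self_of_mem U.2, one_mul, hκ]
  have := sum_moments_mul_moments τ.toLinearMap τ.tracial'
    (fun b => bif b then (U : A) * S * star (U : A) else S)
    (by rintro (_ | _) <;> assumption) κ (by rintro (_ | _) <;> assumption)
    (h.centredWord_eq_zero hU hS hκ) n
  simpa only [cond_true, cond_false, ← mul_assoc] using this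

end Freeness

/-! ### Solving the recursion and matching Jacobi coefficients. -/

section GeneratingFunction

/-- The power series `κ² X C(-κ² X)`, where `C` is the Catalan series. -/
def signedCatalanSeries {R : Type*} [CommRing R] (κ : R) : PowerSeries R :=
  PowerSeries.mk fun k => if k = 0 then 0 else (-1) ^ (k - 1) * catalan (k - 1) * κ ^ (2 * k)

theorem signedCatalanSeries_eq {R : Type*} [CommRing R] (κ : R) :
    signedCatalanSeries κ = κ ^ 2 • (PowerSeries.X *
      PowerSeries.rescale (-κ ^ 2) (PowerSeries.map (Nat.castRingHom R)
        PowerSeries.catalanSeries)) := by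
  ext k
  cases k with
  | zero => simp [signedCatalanSeries]
  | succ k =>
    simp only [signedCatalanSeries, PowerSeries.coeff_mk, map_smul, PowerSeries.coeff_succ_X_mul,
      PowerSeries.coeff_rescale, PowerSeries.coeff_map, PowerSeries.catalanSeries_coeff,
      smul_eq_mul, Nat.add_sub_cancel, eq_natCast, if_neg (Nat.succ_ne_zero k)]
    rw [neg_pow]
    ring

theorem signedCatalanSeries_add_sq {R : Type*} [CommRing R] (κ : R) :
    signedCatalanSeries κ + signedCatalanSeries κ ^ 2 = κ ^ 2 • PowerSeries.X := by
  have h := congrArg (fun f => PowerSeries.rescale (-κ ^ 2)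
    (PowerSeries.map (Nat.castRingHom R) f)) PowerSeries.catalanSeries_sq_mul_X_add_one
  simp only [map_add, map_mul, map_pow, map_one, PowerSeries.map_X, PowerSeries.rescale_X] at h
  rw [signedCatalanSeries_eq]
  generalize PowerSeries.rescale (-κ ^ 2) (PowerSeries.map (Nat.castRingHom R)
        PowerSeries.catalanSeries) = c at *
  rw [PowerSeries.smul_eq_C_mul, PowerSeries.smul_eq_C_mul]
  rw [map_neg] at h
  linear_combination (-PowerSeries.C (κ ^ 2) * PowerSeries.X) * h

/-- The power series `X / (1 - X)²`. -/
def koebeSeries (R : Type*) [CommRing R] : PowerSeries R :=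
  PowerSeries.X * PowerSeries.mk 1 ^ 2

theorem coeff_koebeSeries_pow (R : Type*) [CommRing R] (k n : ℕ) :
    PowerSeries.coeff n (koebeSeries R ^ (k + 1)) = ((n + k).choose (2 * k + 1) : ℕ) := by
  rw [koebeSeries, mul_pow, ← pow_mul, show 2 * (k + 1) = 2 * k + 1 + 1 by ring,
    PowerSeries.mk_one_pow_eq_mk_choose_add, PowerSeries.coeff_X_pow_mul']
  split_ifs with h
  · rw [PowerSeries.coeff_mk]
    congr 2
    omega
  · rw [Nat.choose_eq_zero_of_lt (by omega), Nat.cast_zero]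

theorem hasSubst_koebeSeries (R : Type*) [CommRing R] :
    PowerSeries.HasSubst (koebeSeries R) :=
  PowerSeries.HasSubst.of_constantCoeff_zero' (by simp [koebeSeries])

theorem coeff_koebeSeries (R : Type*) [CommRing R] (n : ℕ) :
    PowerSeries.coeff n (koebeSeries R) = n := by
  simpa using coeff_koebeSeries_pow R 0 n

theorem coeff_subst_koebeSeries {R : Type*} [CommRing R] (κ : R) (n : ℕ) :
    PowerSeries.coeff n ((signedCatalanSeries κ).subst (koebeSeries R)) =
      ∑ k ∈ Finset.range n,
        (-1) ^ k * catalan k * ((n + k).choose (2 * k + 1) : ℕ) * κ ^ (2 * (k + 1)) := by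
  rw [PowerSeries.coeff_subst' (hasSubst_koebeSeries R),
    finsum_eq_sum_of_support_subset (s := Finset.range (n + 1)), Finset.sum_range_succ']
  · simp only [signedCatalanSeries, PowerSeries.coeff_mk, if_neg (Nat.succ_ne_zero _),
      Nat.add_sub_cancel, coeff_koebeSeries_pow, smul_eq_mul, if_true, zero_mul, add_zero]
    exact Finset.sum_congr rfl fun k _ => by ring
  · intro k hk
    by_contra hk'
    apply hk
    cases k with
    | zero => simp at hk'
    | succ k =>
      -- Here `n ≤ k`, so `n + k < 2 * k + 1` and the binomial coefficient vanishes.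
      simp only [Finset.coe_range, Set.mem_Iio, not_lt] at hk'
      simp only [coeff_koebeSeries_pow]
      rw [Nat.choose_eq_zero_of_lt (by omega), Nat.cast_zero, smul_zero]

theorem eq_of_sum_mul_eq {R : Type*} [CommRing R] [IsDomain R] (κ : R) (r : ℕ → R) (h0 : r 0 = 1)
    (h : ∀ n, ∑ j ∈ Finset.range n, r (j + 1) * r (n - 1 - j) = n * κ ^ 2) (n : ℕ) (hn : 1 ≤ n) :
    r n = ∑ k ∈ Finset.range n,
      (-1) ^ k * catalan k * ((n + k).choose (2 * k + 1) : ℕ) * κ ^ (2 * (k + 1)) := by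
  set F : PowerSeries R := PowerSeries.mk r - 1 with hF
  set G := (signedCatalanSeries κ).subst (koebeSeries R) with hG
  have hF2 : F + F ^ 2 = κ ^ 2 • koebeSeries R := by
    have hc : F + F ^ 2 = F * PowerSeries.mk r := by rw [hF]; ring
    rw [hc]
    ext n
    rw [PowerSeries.coeff_mul, Finset.Nat.sum_antidiagonal_eq_sum_range_succ_mk,
      Finset.sum_range_succ', map_smul, coeff_koebeSeries]
    have e0 : PowerSeries.coeff 0 F = 0 := by simp [hF, h0]
    have e1 (j : ℕ) : PowerSeries.coeff (j + 1) F = r (j + 1) := by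
      simp [hF, PowerSeries.coeff_one]
    simp only [e0, e1, PowerSeries.coeff_mk, zero_mul, add_zero, smul_eq_mul]
    rw [mul_comm, ← h n]
    refine Finset.sum_congr rfl fun j hj => ?_
    rw [show n - (j + 1) = n - 1 - j by omega]
  have hG2 : G + G ^ 2 = κ ^ 2 • koebeSeries R := by
    have hs := hasSubst_koebeSeries R
    have := congrArg (PowerSeries.subst (koebeSeries R)) (signedCatalanSeries_add_sq κ)
    rwa [PowerSeries.subst_add hs, PowerSeries.subst_pow hs, PowerSeries.subst_smul hs,
      PowerSeries.subst_X hs] at this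
  -- Both series solve the same quadratic; the second factor has constant term `1`, so it cannot
  -- vanish.
  have hprod : (F - G) * (1 + F + G) = 0 := by linear_combination hF2 - hG2
  have hne : 1 + F + G ≠ 0 := by
    intro h1
    have h2 := congrArg (PowerSeries.coeff 0) h1
    rw [map_add, coeff_subst_koebeSeries] at h2
    simp [hF, h0] at h2
  have hFG : F = G := sub_eq_zero.mp ((mul_eq_zero.mp hprod).resolve_right hne)
  rw [← coeff_subst_koebeSeries, ← hG, ← hFG, hF, map_sub, PowerSeries.coeff_mk,
    PowerSeries.coeff_one, if_neg (by omega), sub_zero]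

/-- Both sides are quotients of factorials. The factor `2 * k + 1` is the one cancelled by
integrating `s ^ (2 * k)`. -/
theorem jacobi_coeff_eq (m k : ℕ) (hk : k ≤ m) :
    (ascPochhammer ℝ (m - k)).eval ((1 : ℝ) + k + 1) *
      (ascPochhammer ℝ k).eval ((m : ℝ) + 1 + 0 + 1) / ((k.factorial : ℝ) * ((m - k).factorial : ℝ))
      = (2 * k + 1) * (catalan k * ((m + 1 + k).choose (2 * k + 1) : ℕ)) := by
  obtain ⟨d, rfl⟩ := Nat.exists_eq_add_of_le hk
  have h1 : ((k + 1).factorial : ℝ) * (ascPochhammer ℝ d).eval ((1 : ℝ) + k + 1)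
      = (k + 1 + d).factorial := by
    rw [show (1 : ℝ) + k + 1 = ((k + 1 + 1 : ℕ) : ℝ) by push_cast; ring,
      ← ascPochhammer_eval_cast, ascPochhammer_nat_eq_ascFactorial, ← Nat.cast_mul,
      Nat.factorial_mul_ascFactorial]
  have h2 : ((k + d + 1).factorial : ℝ) * (ascPochhammer ℝ k).eval (((k + d : ℕ) : ℝ) + 1 + 0 + 1)
      = (k + d + 1 + k).factorial := by
    rw [show ((k + d : ℕ) : ℝ) + 1 + 0 + 1 = ((k + d + 1 + 1 : ℕ) : ℝ) by push_cast; ring,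
      ← ascPochhammer_eval_cast, ascPochhammer_nat_eq_ascFactorial, ← Nat.cast_mul,
      Nat.factorial_mul_ascFactorial]
  have h3 : ((k : ℝ) + 1) * catalan k * (k.factorial * k.factorial) = (2 * k).factorial := by
    have := succ_mul_catalan_eq_centralBinom k
    have h := Nat.choose_mul_factorial_mul_factorial (show k ≤ 2 * k by omega)
    rw [show 2 * k - k = k by omega, ← Nat.centralBinom_eq_two_mul_choose, ← this] at h
    rw [← h]
    push_cast
    ring
  have h4 : ((k + d + 1 + k).choose (2 * k + 1) : ℝ) * ((2 * k + 1) * (2 * k).factorial)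
      * d.factorial = (k + d + 1 + k).factorial := by
    have h := Nat.choose_mul_factorial_mul_factorial (show 2 * k + 1 ≤ k + d + 1 + k by omega)
    rw [show k + d + 1 + k - (2 * k + 1) = d by omega, Nat.factorial_succ] at h
    rw [← h]
    push_cast
    ring
  rw [show k + 1 + d = k + d + 1 by ring] at h1
  rw [← h3, ← h2, ← h1, Nat.factorial_succ k] at h4
  push_cast at h4
  have hk0 : (k.factorial : ℝ) ≠ 0 := by positivity
  have hd0 : (d.factorial : ℝ) ≠ 0 := by positivity
  rw [Nat.add_sub_cancel_left, div_eq_iff (by positivity)]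
  have : ((k : ℝ) + 1) * k.factorial ≠ 0 := by positivity
  apply mul_left_cancel₀ this
  push_cast at h4 ⊢
  linear_combination -h4

theorem mul_integral_jacobiPoly (κ : ℝ) (m : ℕ) :
    κ * ∫ s in (0 : ℝ)..κ, (jacobiPoly 1 0 m).eval (1 - 2 * s ^ 2) =
      ∑ k ∈ Finset.range (m + 1),
        (-1) ^ k * catalan k * ((m + 1 + k).choose (2 * k + 1) : ℕ) * κ ^ (2 * (k + 1)) := by
  have h (s : ℝ) : (jacobiPoly 1 0 m).eval (1 - 2 * s ^ 2) = ∑ k ∈ Finset.range (m + 1),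
      (2 * k + 1) * (catalan k * ((m + 1 + k).choose (2 * k + 1) : ℕ)) * (-1) ^ k
        * s ^ (2 * k) := by
    rw [jacobiPoly, eval_finsetSum]
    refine Finset.sum_congr rfl fun k hk => ?_
    rw [eval_mul, eval_C, jacobi_coeff_eq m k (by simpa [Nat.lt_succ_iff] using hk), eval_pow,
      eval_mul, eval_C, eval_sub, eval_X, eval_one,
      show (1 / 2 : ℝ) * (1 - 2 * s ^ 2 - 1) = -s ^ 2 by ring, neg_pow, ← pow_mul]
    ring
  simp_rw [h]
  rw [intervalIntegral.integral_finsetSum fun k _ => by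
    apply Continuous.intervalIntegrable; fun_prop, Finset.mul_sum]
  refine Finset.sum_congr rfl fun k _ => ?_
  rw [intervalIntegral.integral_const_mul, integral_pow]
  have : (2 * (k : ℝ) + 1) ≠ 0 := by positivity
  push_cast
  rw [zero_pow (by omega)]
  field_simp
  ring

end GeneratingFunction

/-! ### Moments of the spectral distribution. -/

section SpectralDistribution

variable {A : Type*} [CStarAlgebra A]

theorem FaithfulTracialState.im_eq_zero_of_isSelfAdjoint (τ : FaithfulTracialState A) {a : A}
    (ha : IsSelfAdjoint a) : (τ a).im = 0 := by
  have h1 := (Complex.nonneg_iff.mp (τ.nonneg' (1 + a))).2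
  have h2 := (Complex.nonneg_iff.mp (τ.nonneg' (1 - a))).2
  -- Polarization: a self-adjoint element is a difference of positive ones, on which `τ` is real.
  have h : (4 : ℝ) • a = star (1 + a) * (1 + a) - star (1 - a) * (1 - a) := by
    rw [star_add, star_sub, ha.star_eq, star_one, add_mul, sub_mul, mul_add, mul_sub, mul_add,
      mul_sub]
    simp only [one_mul, mul_one]
    module
  have h3 := congrArg (fun x => (τ x).im) h
  rw [← Complex.coe_smul] at h3
  simp only [map_sub, Complex.sub_im, ← h1, ← h2, map_smul, smul_eq_mul,
    Complex.im_ofReal_mul] at h3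
  linarith

theorem integral_ofReal_spectralDistribution (τ : FaithfulTracialState A) (w : unitary A)
    (f : C(Metric.sphere (0 : ℂ) 1, ℝ)) :
    ∫ z, (f z : ℂ) ∂(spectralDistribution τ w) =
      τ (circleCalculus w ⟨fun z => (f z : ℂ), by fun_prop⟩) := by
  have h := RealRMK.integral_rieszMeasure (spectralFunctional τ w)
    (⟨f, HasCompactSupport.of_compactSpace _⟩ :
      CompactlySupportedContinuousMap (Metric.sphere (0 : ℂ) 1) ℝ)
  have hsa : IsSelfAdjoint (circleCalculus w ⟨fun z => (f z : ℂ), by fun_prop⟩) := by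
    rw [IsSelfAdjoint, ← map_star]
    congr 1
    ext z
    simp
  rw [integral_complex_ofReal]
  refine Complex.ext ?_ ?_
  · rw [Complex.ofReal_re]
    exact h
  · rw [Complex.ofReal_im, τ.im_eq_zero_of_isSelfAdjoint hsa]

theorem integral_spectralDistribution (τ : FaithfulTracialState A) (w : unitary A)
    (f : C(Metric.sphere (0 : ℂ) 1, ℂ)) :
    ∫ z, f z ∂(spectralDistribution τ w) = τ (circleCalculus w f) := by
  have hre := integral_ofReal_spectralDistribution τ w ⟨fun z => (f z).re, by fun_prop⟩
  have him := integral_ofReal_spectralDistribution τ w ⟨fun z => (f z).im, by fun_prop⟩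
  have : IsFiniteMeasure (spectralDistribution τ w) := by
    unfold spectralDistribution
    infer_instance
  have hint : Integrable f (spectralDistribution τ w) :=
    f.continuous.integrable_of_hasCompactSupport (HasCompactSupport.of_compactSpace _)
  have hf : f = (⟨fun z => ((f z).re : ℂ), by fun_prop⟩ : C(Metric.sphere (0 : ℂ) 1, ℂ)) +
      Complex.I • ⟨fun z => ((f z).im : ℂ), by fun_prop⟩ := by
    ext z
    simp [mul_comm Complex.I, Complex.re_add_im]
  rw [← integral_re_add_im hint]
  conv_rhs => rw [hf, map_add, map_smul, map_add, map_smul]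
  rw [smul_eq_mul, mul_comm Complex.I]
  simp only [ContinuousMap.coe_mk] at hre him
  rw [← hre, ← him, integral_complex_ofReal, integral_complex_ofReal]
  rfl

theorem circleCalculus_id (w : unitary A) :
    circleCalculus w ⟨fun z => (z : ℂ), continuous_subtype_val⟩ = (w : A) := by
  rw [circleCalculus, StarAlgHom.comp_apply]
  exact cfcHom_id (R := ℂ) (a := (w : A)) (p := IsStarNormal) inferInstance

theorem integral_pow_spectralDistribution (τ : FaithfulTracialState A) (w : unitary A) (n : ℕ) :
    ∫ z : Metric.sphere (0 : ℂ) 1, (z : ℂ) ^ n ∂(spectralDistribution τ w) = τ ((w : A) ^ n) := by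
  rw [← circleCalculus_id w, ← map_pow, ← integral_spectralDistribution]
  rfl

end SpectralDistribution
end

theorem mainTheorem8 {A : Type*} [CStarAlgebra A] [WStarAlgebra A]
    (τ : FaithfulTracialState A)
    (P : A) (hP : IsStarProjection P)
    (U : unitary A) (hU : IsHaarUnitary τ U)
    (hfree : IsStarFree τ ![{P}, {(U : A)}])
    (S : unitary A) (hS : (S : A) = 2 * P - 1)
    (κ : ℝ) (hκ : κ ∈ Set.Ioc (-1) 1) (hτ : τ (S : A) = (κ : ℂ))
    (n : ℕ) (hn : 1 ≤ n) :
    ∫ z : Metric.sphere (0 : ℂ) 1, (z : ℂ) ^ n ∂(spectralDistribution τ (S * U * S * star U))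
        = τ (((S : A) * (U : A) * (S : A) * star (U : A)) ^ n) ∧
      τ (((S : A) * (U : A) * (S : A) * star (U : A)) ^ n)
        = ((κ * ∫ s in (0 : ℝ)..κ, (jacobiPoly 1 0 (n - 1)).eval (1 - 2 * s ^ 2) : ℝ) : ℂ) := by
  refine ⟨integral_pow_spectralDistribution τ _ n, ?_⟩
  have h := eq_of_sum_mul_eq (κ : ℂ)
    (fun j => τ (((S : A) * (U : A) * (S : A) * star (U : A)) ^ j))
    (by simpa using τ.map_one') (fun m => sum_moments_of_isStarFree hP hU hfree hS hτ m) n hn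
  rw [mul_integral_jacobiPoly, Nat.sub_add_cancel hn]
  refine h.trans ?_
  push_cast
  rfl
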